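/- Let $\mathcal H$ be a complex Hilbert space, let $\psi_1,\dots,\psi_n$ and $\phi_1,\dots,\phi_n$ be two families of $n$ orthonormal vectors of $\mathcal H$, and let $$\Psi=\frac1{\sqrt{n!}}\sum_{\tau\in\mathfrak S_n}(-1)^\tau\bigotimes_{i=1}^n\psi_{\tau(i)},\qquad \Phi=\frac1{\sqrt{n!}}\sum_{\tau\in\mathfrak S_n}(-1)^\tau\bigotimes_{i=1}^n\phi_{\tau(i)}$$ be the associated Slater determinants in the Hilbert tensor power $\mathcal H^{\otimes n}$. A state operator is a nonnegative trace-class operator of trace one. For a finite set $S$ of sites and a bounded operator $X$ on $\mathcal H^{\otimes S}$, let $\|X\|_{W_1}$ be the infimum of $\sum_{s\in S}c_s$ over all representations $X=\sum_{s\in S}c_s(\rho_s-\sigma_s)$ with $c_s\ge 0$ and state operators $\rho_s,\sigma_s$ on $\mathcal H^{\otimes S}$ such that $\operatorname{tr}_s\rho_s=\operatorname{tr}_s\sigma_s$ for every $s$, where $\operatorname{tr}_s$ is the partial trace over the site $s$ (and $\|X\|_{W_1}=\infty$ if there is no such representation). The quantum Wasserstein distance of order $1$ of two state operators $\rho,\sigma$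 is $\|\rho-\sigma\|_{W_1}$. Let $K_\Phi=\sum_{\ell=1}^n|\phi_\ell\rangle\langle\phi_\ell|$, let $\mathfrak U_\Phi$ be the set of unitary operators $U$ on $\mathcal H$ with $UK_\Phi U^\dagger=K_\Phi$, and define $K_\Psi$, $\mathfrak U_\Psi$ likewise from $\psi_1,\dots,\psi_n$. For $1\le k\le n$ let $\Gamma^{(k)}_\Phi=\binom nk\operatorname{tr}_{k+1,\dots,n}\big[|\Phi\rangle\langle\Phi|\big]$ be the $k$-particle reduced density matrix, an operator on $\mathcal H^{\otimes k}$, and define $\Gamma^{(k)}_\Psi$ likewise. Then the maximum below is attained, and $$\big\|\,|\Psi\rangle\langle\Psi|-|\Phi\rangle\langle\Phi|\,\big\|_{W_1}\le n\sqrt{1-\max_{V\in\mathfrak U_\Psi,\;U\in\mathfrak U_\Phi}\Big|\frac1n\sum_{i=1}^n\langle V\psi_i\,|\,U\phi_i\rangle\Big|^2}.$$ Moreover, the sequence $$k\mapsto\frac1k\Big\|\binom nk^{-1}\Gamma^{(k)}_\Phi-\binom nk^{-1}\Gamma^{(k)}_\Psi\Big\|_{W_1}$$ is non-decreasing for $k=1,\dots,n$.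 -/

import Mathlib

open scoped ENNReal lp

namespace QSlater

noncomputable section

/-- The Hilbert tensor power `H^{⊗S}`, with one tensor factor for each site of the finite type `S`,
of a Hilbert space `H` with an orthonormal basis indexed by `ι`: the space of square-summable
families of coefficients with respect to the product basis, which is indexed by `S → ι`.
The basis may be infinite. -/
abbrev TensorPow (ι S : Type*) : Type _ := ℓ²(S → ι, ℂ)

/-- The product orthonormal basis of `H^{⊗S}`. -/
def prodBasis (ι S : Type*) : HilbertBasis (S → ι) ℂ (TensorPow ι S) :=
  HilbertBasis.ofRepr (LinearIsometryEquiv.refl ℂ _)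

section Vectors

variable {ι H S : Type*} [NormedAddCommGroup H] [InnerProductSpace ℂ H] [Fintype S]

/-- The coefficients of a product vector are square-summable. -/
theorem memlp_prod (b : HilbertBasis ι ℂ H) (v : S → H) :
    Memℓp (fun x : S → ι => ∏ s, inner ℂ (b (x s)) (v s)) 2 := by
  classical
  apply memℓp_gen
  have hsum : ∀ s, Summable fun i => ‖inner ℂ (b i) (v s)‖ ^ 2 := by
    intro s
    have h := (lp.memℓp (b.repr (v s))).summable (by norm_num)
    simpa [b.repr_apply_apply] using h
  refine summable_of_sum_le (c := ∏ s, ∑' i, ‖inner ℂ (b i) (v s)‖ ^ 2)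
    (fun x => by positivity) ?_
  intro u
  have hsub : u ⊆ Fintype.piFinset fun s => u.image fun x => x s := by
    intro x hx
    rw [Fintype.mem_piFinset]
    exact fun s => Finset.mem_image_of_mem _ hx
  calc ∑ x ∈ u, ‖∏ s, inner ℂ (b (x s)) (v s)‖ ^ (2 : ℝ≥0∞).toReal
      = ∑ x ∈ u, ∏ s, ‖inner ℂ (b (x s)) (v s)‖ ^ 2 := by
        refine Finset.sum_congr rfl fun x _ => ?_
        simp [Finset.prod_pow]
    _ ≤ ∑ x ∈ Fintype.piFinset fun s => u.image fun x => x s,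
          ∏ s, ‖inner ℂ (b (x s)) (v s)‖ ^ 2 :=
        Finset.sum_le_sum_of_subset_of_nonneg hsub fun _ _ _ => by positivity
    _ = ∏ s, ∑ i ∈ u.image fun x => x s, ‖inner ℂ (b i) (v s)‖ ^ 2 :=
        (Finset.prod_univ_sum (fun s => u.image fun x => x s)
          (fun s i => ‖inner ℂ (b i) (v s)‖ ^ 2)).symm
    _ ≤ ∏ s, ∑' i, ‖inner ℂ (b i) (v s)‖ ^ 2 :=
        Finset.prod_le_prod (fun _ _ => by positivity)
          fun s _ => (hsum s).sum_le_tsum _ fun _ _ => by positivity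

/-- The product vector `⨂ₛ vₛ` in `H^{⊗S}`. -/
def prodVec (b : HilbertBasis ι ℂ H) (v : S → H) : TensorPow ι S :=
  ⟨fun x => ∏ s, inner ℂ (b (x s)) (v s), memlp_prod b v⟩

/-- The Slater determinant `(n!)^{-1/2} ∑_τ (-1)^τ ⨂ᵢ ψ_{τ(i)}`. -/
def slater (b : HilbertBasis ι ℂ H) {n : ℕ} (ψ : Fin n → H) : TensorPow ι (Fin n) :=
  ((Real.sqrt (n.factorial : ℝ))⁻¹ : ℂ) •
    ∑ τ : Equiv.Perm (Fin n), ((Equiv.Perm.sign τ : ℤ) : ℂ) • prodVec b fun i => ψ (τ i)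

end Vectors

section OneParticle

variable {H : Type*} [NormedAddCommGroup H] [InnerProductSpace ℂ H]

/-- The one-particle projection `K_Φ = ∑ₗ |φₗ⟩⟨φₗ|`. -/
def oneParticleProj {n : ℕ} (φ : Fin n → H) : H →L[ℂ] H :=
  ∑ l, InnerProductSpace.rankOne ℂ (φ l) (φ l)

/-- The unitaries `U` of `H` with `U K_Φ U† = K_Φ`. -/
def stabilizer [CompleteSpace H] {n : ℕ} (φ : Fin n → H) : Set (H →L[ℂ] H) :=
  {U | U ∈ unitary (H →L[ℂ] H) ∧ U * oneParticleProj φ * star U = oneParticleProj φ}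

/-- The set of the numbers `|(1/n) ∑ᵢ ⟨V ψᵢ | U φᵢ⟩|²`, for `V` and `U` in the stabilizers of the
one-particle projections of `ψ` and `φ` respectively. -/
def overlaps [CompleteSpace H] {n : ℕ} (ψ φ : Fin n → H) : Set ℝ :=
  {r | ∃ V ∈ stabilizer ψ, ∃ U ∈ stabilizer φ,
    r = ‖(1 / (n : ℂ)) * ∑ i, inner ℂ (V (ψ i)) (U (φ i))‖ ^ 2}

end OneParticle

section States

variable {ι S : Type*}

/-- State operators: nonnegative operators of trace one. The trace of a nonnegative operator is the
sum of its diagonal entries in an orthonormal basis; when finite, the operator is trace-class. -/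
def IsState (ρ : TensorPow ι S →L[ℂ] TensorPow ι S) : Prop :=
  ρ.IsPositive ∧
    HasSum (fun x : S → ι => inner ℂ (prodBasis ι S x) (ρ (prodBasis ι S x))) 1

/-- The product basis index which is `x` on the sites with `p` and `z` on the other sites. -/
def merge (p : S → Prop) [DecidablePred p] (x : {s // p s} → ι) (z : {s // ¬ p s} → ι) : S → ι :=
  (Equiv.piEquivPiSubtypeProd p fun _ => ι).symm (x, z)

/-- For fixed `z`, the product basis vectors `e_x ⊗ e_z` are orthonormal. -/
theorem orthonormal_merge (p : S → Prop) [DecidablePred p] (z : {s // ¬ p s} → ι) :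
    Orthonormal ℂ fun x : {s // p s} → ι => prodBasis ι S (merge p x z) :=
  (prodBasis ι S).orthonormal.comp _ fun x y h => by
    have := (Equiv.piEquivPiSubtypeProd p fun _ : S => ι).symm.injective h
    exact (Prod.ext_iff.1 this).1

/-- The isometry `1 ⊗ |e_z⟩ : u ↦ u ⊗ e_z`, with `u` on the sites with `p` and the product basis
vector `e_z` on the other sites. -/
def insertBasis (p : S → Prop) [DecidablePred p] (z : {s // ¬ p s} → ι) :
    TensorPow ι {s // p s} →L[ℂ] TensorPow ι S :=
  (orthonormal_merge p z).orthogonalFamily.linearIsometry.toContinuousLinearMap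

/-- The partial trace `∑_z (1 ⊗ ⟨e_z|) ρ (1 ⊗ |e_z⟩)`, which keeps the sites with `p` and traces out
the others. For trace-class `ρ` the series converges absolutely in operator norm. -/
def ptrace (p : S → Prop) [DecidablePred p] (ρ : TensorPow ι S →L[ℂ] TensorPow ι S) :
    TensorPow ι {s // p s} →L[ℂ] TensorPow ι {s // p s} :=
  ∑' z, (insertBasis p z).adjoint ∘L ρ ∘L insertBasis p z

/-- The quantum Wasserstein norm of order one of `X` (a difference of two state operators):
the infimum of `∑ₛ cₛ` over all `X = ∑ₛ cₛ (ρₛ - σₛ)` with `cₛ ≥ 0` and `ρₛ`, `σₛ` state operators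
having the same partial trace over the site `s`; it is `∞` if there is no such representation. -/
def w1Norm [Fintype S] [DecidableEq S] (X : TensorPow ι S →L[ℂ] TensorPow ι S) : ℝ≥0∞ :=
  sInf {w | ∃ (c : S → ℝ) (ρ σ : S → TensorPow ι S →L[ℂ] TensorPow ι S),
    (∀ s, 0 ≤ c s) ∧ (∀ s, IsState (ρ s)) ∧ (∀ s, IsState (σ s)) ∧
    (∀ s, ptrace (fun t => t ≠ s) (ρ s) = ptrace (fun t => t ≠ s) (σ s)) ∧
    X = ∑ s, (c s : ℂ) • (ρ s - σ s) ∧ w = ENNReal.ofReal (∑ s, c s)}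

/-- The pure state `|Φ⟩⟨Φ|`. -/
def pureState (Φ : TensorPow ι S) : TensorPow ι S →L[ℂ] TensorPow ι S :=
  InnerProductSpace.rankOne ℂ Φ Φ

/-- The `k`-particle reduced density matrix `Γ^{(k)}_Φ = (n choose k) tr_{k+1,…,n} |Φ⟩⟨Φ|`, an
operator on the tensor power over the first `k` of the `n` sites (for `k ≤ n`). -/
def reducedDensity {n : ℕ} (k : ℕ) (Φ : TensorPow ι (Fin n)) :
    TensorPow ι {j : Fin n // (j : ℕ) < k} →L[ℂ] TensorPow ι {j : Fin n // (j : ℕ) < k} :=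
  (n.choose k : ℂ) • ptrace (fun j : Fin n => (j : ℕ) < k) (pureState Φ)

end States

end

end QSlater

/-! The bound is a hybrid argument. Let site `i` carry its own orthonormal family `χ i` in the
antisymmetrized product (`hybrid`), and replace `ψ` by `φ` one site at a time. Two consecutive
hybrids differ only at one site `s`, and two facts hold there. Tracing out `s` sees the family at
`s` only through its Gram matrix, the identity, so both hybrids have the same reduced state off `s`
(`ptrace_ne_hybrid_congr`). Their overlap is `(1/n) ∑ᵢ ⟨ψᵢ|φᵢ⟩`, since orthonormality at the other
sites kills all cross terms (`inner_hybrid`). A difference of pure states with overlap `z` is `√(1 -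
|z|²)` times a difference of pure states (`exists_rankOne_sub_eq`), so each of the `n` links costs
this root, and the links telescope.

An element of a stabilizer acts on the span of the family as a unitary matrix, which multiplies the
Slater vector by a determinant of modulus one. Hence `ψ` and `φ` may be rotated freely in the bound.
The overlaps are a continuous image of the compact set `U(n) × U(n)`, so the maximum is attained.

For monotonicity, antisymmetry lets the `k`-particle state be obtained from the `(k+1)`-particle
state by tracing out any one site. Trace out the site of largest cost in a given representation: its
term vanishes, the other terms stay admissible, and at most `k/(k+1)` of the cost remains
(`inv_mul_w1Norm_ptrace_le`). -/

namespace QSlater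

noncomputable section

/-! ### Matrix entries and positive operators on `ℓ²` -/

section MatrixEntries

variable {X Y Z : Type*}

/-- The standard Hilbert basis of `ℓ²(X)`. -/
def stdBasis (X : Type*) : HilbertBasis X ℂ ℓ²(X, ℂ) :=
  HilbertBasis.ofRepr (LinearIsometryEquiv.refl ℂ _)

theorem inner_stdBasis (x : X) (u : ℓ²(X, ℂ)) : inner ℂ (stdBasis X x) u = u x := by
  rw [← (stdBasis X).repr_apply_apply]
  rfl

/-- The matrix entry `⟨e_x | T e_y⟩`. -/
def entry (T : ℓ²(X, ℂ) →L[ℂ] ℓ²(X, ℂ)) (x y : X) : ℂ :=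
  inner ℂ (stdBasis X x) (T (stdBasis X y))

theorem ext_entry {T T' : ℓ²(X, ℂ) →L[ℂ] ℓ²(X, ℂ)} (h : ∀ x y, entry T x y = entry T' x y) :
    T = T' := by
  have key : ∀ y, T (stdBasis X y) = T' (stdBasis X y) := by
    intro y
    ext x
    simpa [entry, inner_stdBasis] using h x y
  refine ContinuousLinearMap.ext_on (s := Set.range (stdBasis X)) ?_ ?_
  · have := (stdBasis X).dense_span
    rw [← Submodule.dense_iff_topologicalClosure_eq_top] at this
    exact this
  · rintro _ ⟨y, rfl⟩
    exact key y

/-- Nonnegative operators of trace one on `ℓ²(X)`. -/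
def IsDensity (ρ : ℓ²(X, ℂ) →L[ℂ] ℓ²(X, ℂ)) : Prop :=
  ρ.IsPositive ∧ HasSum (fun x => entry ρ x x) 1

/-- The positive square root serves as `S`. The entries of `T` become inner products of the vectors
`S e_x`, to which Cauchy–Schwarz applies. -/
theorem exists_adjoint_comp_self_eq {E : Type*} [NormedAddCommGroup E] [InnerProductSpace ℂ E]
    [CompleteSpace E] {T : E →L[ℂ] E} (hT : T.IsPositive) :
    ∃ S : E →L[ℂ] E, S.adjoint ∘L S = T := by
  have h0 : 0 ≤ T := (ContinuousLinearMap.nonneg_iff_isPositive T).2 hT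
  refine ⟨CFC.sqrt T, ?_⟩
  have h1 : IsSelfAdjoint (CFC.sqrt T) := (CFC.sqrt_nonneg T).isSelfAdjoint
  rw [← ContinuousLinearMap.star_eq_adjoint, h1.star_eq]
  exact CFC.sqrt_mul_sqrt_self T h0

theorem entry_adjoint_comp_self (S : ℓ²(X, ℂ) →L[ℂ] ℓ²(X, ℂ)) (x y : X) :
    entry (S.adjoint ∘L S) x y = inner ℂ (S (stdBasis X x)) (S (stdBasis X y)) := by
  simp [entry, ContinuousLinearMap.adjoint_inner_right]

/-- Cauchy–Schwarz for a Gram matrix, weakened to a sum so that summable diagonals dominate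
off-diagonal series. -/
theorem norm_entry_le {T : ℓ²(X, ℂ) →L[ℂ] ℓ²(X, ℂ)} (hT : T.IsPositive) (x y : X) :
    ‖entry T x y‖ ≤ (entry T x x).re + (entry T y y).re := by
  obtain ⟨S, rfl⟩ := exists_adjoint_comp_self_eq hT
  simp only [entry_adjoint_comp_self]
  rw [inner_self_eq_norm_sq_to_K, inner_self_eq_norm_sq_to_K]
  simp only [Complex.coe_algebraMap, ← Complex.ofReal_pow, Complex.ofReal_re]
  have := norm_inner_le_norm (𝕜 := ℂ) (S (stdBasis X x)) (S (stdBasis X y))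
  nlinarith [sq_nonneg (‖S (stdBasis X x)‖ - ‖S (stdBasis X y)‖),
    sq_nonneg (‖S (stdBasis X x)‖), sq_nonneg (‖S (stdBasis X y)‖)]

/-- The operator norm of a nonnegative operator is at most its trace. -/
theorem norm_le_of_hasSum_entry {T : ℓ²(X, ℂ) →L[ℂ] ℓ²(X, ℂ)} (hT : T.IsPositive) {t : ℝ}
    (ht : HasSum (fun x => (entry T x x).re) t) : ‖T‖ ≤ t := by
  obtain ⟨S, rfl⟩ := exists_adjoint_comp_self_eq hT
  have hd : ∀ x, (entry (S.adjoint ∘L S) x x).re = ‖S (stdBasis X x)‖ ^ 2 := by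
    intro x
    rw [entry_adjoint_comp_self, inner_self_eq_norm_sq_to_K]
    norm_cast
  simp only [hd] at ht
  have ht0 : 0 ≤ t := ht.nonneg fun x => by positivity
  -- Here `t` is the squared Hilbert–Schmidt norm of `S`; Cauchy–Schwarz on the partial sums of `S u
  -- = ∑ u_x S e_x` bounds the operator norm by its root.
  have hS : ‖S‖ ≤ Real.sqrt t := by
    refine S.opNorm_le_bound (Real.sqrt_nonneg _) fun u => ?_
    have h1 : HasSum (fun x => u x • S (stdBasis X x)) (S u) := by
      have := ((stdBasis X).hasSum_repr u).mapL S
      simp only [map_smul] at this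
      exact this
    have h2 : HasSum (fun x => ‖u x‖ ^ 2) (‖u‖ ^ 2) := by
      have := lp.hasSum_norm (p := 2) (by norm_num) u
      simpa using this
    refine le_of_tendsto h1.norm ?_
    refine Filter.Eventually.of_forall fun F => ?_
    calc ‖∑ x ∈ F, u x • S (stdBasis X x)‖ ≤ ∑ x ∈ F, ‖u x‖ * ‖S (stdBasis X x)‖ := by
          refine (norm_sum_le _ _).trans (Finset.sum_le_sum fun x _ => ?_)
          rw [norm_smul]
      _ ≤ Real.sqrt (∑ x ∈ F, ‖u x‖ ^ 2) * Real.sqrt (∑ x ∈ F, ‖S (stdBasis X x)‖ ^ 2) :=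
          Real.sum_mul_le_sqrt_mul_sqrt _ _ _
      _ ≤ Real.sqrt (‖u‖ ^ 2) * Real.sqrt t := by
          gcongr
          · exact sum_le_hasSum _ (fun _ _ => by positivity) h2
          · exact sum_le_hasSum _ (fun _ _ => by positivity) ht
      _ = Real.sqrt t * ‖u‖ := by rw [Real.sqrt_sq (norm_nonneg _), mul_comm]
  calc ‖S.adjoint ∘L S‖ ≤ ‖S.adjoint‖ * ‖S‖ := ContinuousLinearMap.opNorm_comp_le _ _
    _ = ‖S‖ * ‖S‖ := by rw [LinearIsometryEquiv.norm_map]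
    _ ≤ Real.sqrt t * Real.sqrt t := by gcongr
    _ = t := Real.mul_self_sqrt ht0

theorem entry_rankOne (u v : ℓ²(X, ℂ)) (x y : X) :
    entry (InnerProductSpace.rankOne ℂ u v) x y = u x * star (v y) := by
  rw [entry, InnerProductSpace.rankOne_apply, inner_smul_right, inner_stdBasis,
    ← inner_conj_symm, inner_stdBasis, mul_comm]
  rfl

theorem isDensity_rankOne {u : ℓ²(X, ℂ)} (hu : ‖u‖ = 1) :
    IsDensity (InnerProductSpace.rankOne ℂ u u) := by
  refine ⟨InnerProductSpace.isPositive_rankOne_self u, ?_⟩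
  have := lp.hasSum_inner (𝕜 := ℂ) u u
  rw [inner_self_eq_norm_sq_to_K, hu] at this
  simp only [entry_rankOne]
  simpa [Complex.mul_conj'] using this

end MatrixEntries

/-! ### Partial traces along a splitting of the index set -/

section PartialTrace

open scoped ComplexOrder

variable {X Y Z : Type*} (e : X × Z ≃ Y)

theorem orthonormal_slot (z : Z) : Orthonormal ℂ fun x : X => stdBasis Y (e (x, z)) :=
  (stdBasis Y).orthonormal.comp _ fun x y h => by
    have := e.injective h
    exact (Prod.ext_iff.1 this).1

/-- The isometry `e_x ↦ e_{(x, z)}`. -/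
def slot (z : Z) : ℓ²(X, ℂ) →L[ℂ] ℓ²(Y, ℂ) :=
  (orthonormal_slot e z).orthogonalFamily.linearIsometry.toContinuousLinearMap

theorem slot_stdBasis (z : Z) (x : X) : slot e z (stdBasis X x) = stdBasis Y (e (x, z)) := by
  classical
  have h : stdBasis X x = lp.single 2 x (1 : ℂ) := by
    rw [← (stdBasis X).repr_self]
    rfl
  rw [h]
  exact ((orthonormal_slot e z).orthogonalFamily.linearIsometry_apply_single (1 : ℂ)).trans
    (by simp)

/-- The partial trace over the second factor of `Y ≃ X × Z`. -/
def partialTrace (ρ : ℓ²(Y, ℂ) →L[ℂ] ℓ²(Y, ℂ)) : ℓ²(X, ℂ) →L[ℂ] ℓ²(X, ℂ) :=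
  ∑' z, (slot e z).adjoint ∘L ρ ∘L slot e z

/-- The series defining the partial trace converges. -/
def Traceable (ρ : ℓ²(Y, ℂ) →L[ℂ] ℓ²(Y, ℂ)) : Prop :=
  Summable fun z => (slot e z).adjoint ∘L ρ ∘L slot e z

theorem entry_slot (ρ : ℓ²(Y, ℂ) →L[ℂ] ℓ²(Y, ℂ)) (z : Z) (x y : X) :
    entry ((slot e z).adjoint ∘L ρ ∘L slot e z) x y = entry ρ (e (x, z)) (e (y, z)) := by
  simp [entry, ContinuousLinearMap.adjoint_inner_right, slot_stdBasis]

variable {e}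

theorem Traceable.hasSum_inner {ρ : ℓ²(Y, ℂ) →L[ℂ] ℓ²(Y, ℂ)} (h : Traceable e ρ)
    (u v : ℓ²(X, ℂ)) :
    HasSum (fun z => inner ℂ u (((slot e z).adjoint ∘L ρ ∘L slot e z) v))
      (inner ℂ u (partialTrace e ρ v)) := by
  have h1 := h.hasSum.mapL (ContinuousLinearMap.apply ℂ ℓ²(X, ℂ) v)
  exact h1.mapL (innerSL ℂ u)

theorem Traceable.hasSum_entry {ρ : ℓ²(Y, ℂ) →L[ℂ] ℓ²(Y, ℂ)} (h : Traceable e ρ) (x y : X) :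
    HasSum (fun z => entry ρ (e (x, z)) (e (y, z))) (entry (partialTrace e ρ) x y) := by
  have := h.hasSum_inner (stdBasis X x) (stdBasis X y)
  have h2 : (fun z => entry ρ (e (x, z)) (e (y, z))) = fun z => inner ℂ (stdBasis X x)
      (((slot e z).adjoint ∘L ρ ∘L slot e z) (stdBasis X y)) :=
    funext fun z => (entry_slot e ρ z x y).symm
  rw [h2]
  exact this

theorem Traceable.sub {ρ σ : ℓ²(Y, ℂ) →L[ℂ] ℓ²(Y, ℂ)} (hρ : Traceable e ρ)
    (hσ : Traceable e σ) : Traceable e (ρ - σ) := by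
  have := Summable.sub hρ hσ
  refine this.congr fun z => ?_
  simp

theorem partialTrace_sub {ρ σ : ℓ²(Y, ℂ) →L[ℂ] ℓ²(Y, ℂ)} (hρ : Traceable e ρ)
    (hσ : Traceable e σ) :
    partialTrace e (ρ - σ) = partialTrace e ρ - partialTrace e σ := by
  rw [partialTrace, partialTrace, partialTrace, ← Summable.tsum_sub hρ hσ]
  simp

theorem Traceable.smul {ρ : ℓ²(Y, ℂ) →L[ℂ] ℓ²(Y, ℂ)} (hρ : Traceable e ρ) (c : ℂ) :
    Traceable e (c • ρ) := by
  have := Summable.const_smul c hρ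
  refine this.congr fun z => ?_
  simp

theorem partialTrace_smul {ρ : ℓ²(Y, ℂ) →L[ℂ] ℓ²(Y, ℂ)} (hρ : Traceable e ρ) (c : ℂ) :
    partialTrace e (c • ρ) = c • partialTrace e ρ := by
  rw [partialTrace, partialTrace, ← Summable.tsum_const_smul c hρ]
  simp

theorem partialTrace_sum {α : Type*} (F : Finset α) {ρ : α → ℓ²(Y, ℂ) →L[ℂ] ℓ²(Y, ℂ)}
    (hρ : ∀ a, Traceable e (ρ a)) :
    partialTrace e (∑ a ∈ F, ρ a) = ∑ a ∈ F, partialTrace e (ρ a) := by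
  simp only [partialTrace]
  rw [← Summable.tsum_finsetSum fun a _ => hρ a]
  congr 1
  ext1 z
  simp [ContinuousLinearMap.comp_finsetSum, ContinuousLinearMap.finsetSum_comp]

theorem IsDensity.hasSum_re {ρ : ℓ²(Y, ℂ) →L[ℂ] ℓ²(Y, ℂ)} (h : IsDensity ρ) :
    HasSum (fun y => (entry ρ y y).re) 1 := by
  simpa using Complex.hasSum_re h.2

theorem IsDensity.summable_entry {ρ : ℓ²(Y, ℂ) →L[ℂ] ℓ²(Y, ℂ)} (h : IsDensity ρ) {W : Type*}
    {a a' : W → Y} (ha : a.Injective) (ha' : a'.Injective) :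
    Summable fun w => entry ρ (a w) (a' w) :=
  Summable.of_norm_bounded ((h.hasSum_re.summable.comp_injective ha).add
    (h.hasSum_re.summable.comp_injective ha')) fun _ => norm_entry_le h.1 _ _

/-- Each summand is positive, so its operator norm is at most its trace, and these traces add up to
the full trace: convergence is absolute. -/
theorem IsDensity.traceable {ρ : ℓ²(Y, ℂ) →L[ℂ] ℓ²(Y, ℂ)} (h : IsDensity ρ) :
    Traceable e ρ := by
  have h1 : Summable fun w : Z × X => (entry ρ (e (w.2, w.1)) (e (w.2, w.1))).re :=
    h.hasSum_re.summable.comp_injective (e.injective.comp Prod.swap_injective)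
  refine Summable.of_norm_bounded h1.prod fun z => ?_
  refine norm_le_of_hasSum_entry (h.1.adjoint_conj _) ?_
  simp only [entry_slot]
  exact (h1.prod_factor z).hasSum

theorem IsDensity.partialTrace {ρ : ℓ²(Y, ℂ) →L[ℂ] ℓ²(Y, ℂ)} (h : IsDensity ρ) :
    IsDensity (partialTrace e ρ) := by
  constructor
  · rw [ContinuousLinearMap.isPositive_iff_complex]
    intro u
    have h1 := (h.traceable (e := e)).hasSum_inner u u
    have h2 : 0 ≤ inner ℂ u (QSlater.partialTrace e ρ u) :=
      h1.nonneg fun z => (h.1.adjoint_conj (slot e z)).inner_nonneg_right u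
    have h3 : inner ℂ (QSlater.partialTrace e ρ u) u = inner ℂ u (QSlater.partialTrace e ρ u) := by
      rw [← inner_conj_symm]
      exact Complex.conj_eq_iff_im.2 (Complex.nonneg_iff.1 h2).2.symm
    rw [h3]
    refine ⟨?_, (Complex.nonneg_iff.1 h2).1⟩
    exact Complex.ext rfl (Complex.nonneg_iff.1 h2).2
  · have h1 : HasSum (fun w : X × Z => entry ρ (e w) (e w)) 1 := e.hasSum_iff.2 h.2
    exact h1.prod_fiberwise fun x => h.traceable.hasSum_entry x x

end PartialTrace

/-! ### Configurations and tracing out a single site -/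

section Sites

variable {ι S : Type*}

/-- Splitting of the configurations of `S` into those of the sites with `p` and of the others. -/
def siteEquiv (ι : Type*) {S : Type*} (p : S → Prop) [DecidablePred p] :
    ({s // p s} → ι) × ({s // ¬ p s} → ι) ≃ (S → ι) :=
  (Equiv.piEquivPiSubtypeProd p fun _ => ι).symm

theorem siteEquiv_apply (p : S → Prop) [DecidablePred p] (x : {s // p s} → ι)
    (z : {s // ¬ p s} → ι) (s : S) :
    siteEquiv ι p (x, z) s = if h : p s then x ⟨s, h⟩ else z ⟨s, h⟩ := rfl

theorem pureState_isDensity {Φ : TensorPow ι S} (h : ‖Φ‖ = 1) : IsDensity (pureState Φ) :=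
  isDensity_rankOne h

variable [DecidableEq S]

/-- The configuration which is `x` off the site `s` and `i` at the site `s`. -/
def fillSite (s : S) (x : {t // t ≠ s} → ι) (i : ι) : S → ι :=
  fun t => if h : t ≠ s then x ⟨t, h⟩ else i

theorem fillSite_self (s : S) (x : {t // t ≠ s} → ι) (i : ι) : fillSite s x i s = i := by
  simp [fillSite]

theorem fillSite_ne (s : S) (x : {t // t ≠ s} → ι) (i : ι) (t : {t // t ≠ s}) :
    fillSite s x i t = x t := by
  simp [fillSite, t.2]

/-- Configurations of the single site left out by `t ≠ s`. -/
def singleSiteEquiv (ι : Type*) {S : Type*} (s : S) : ι ≃ ({t : S // ¬ t ≠ s} → ι) where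
  toFun i := fun _ => i
  invFun z := z ⟨s, by simp⟩
  left_inv _ := rfl
  right_inv z := by
    ext ⟨t, ht⟩
    obtain rfl : t = s := by simpa using ht
    rfl

/-- `ptrace` unfolds to `partialTrace` along `siteEquiv`; only the site `s` is traced out, so the
sum can be indexed by `ι`. -/
theorem hasSum_entry_ptrace_ne {ρ : TensorPow ι S →L[ℂ] TensorPow ι S} (hρ : IsDensity ρ) (s : S)
    (x x' : {t // t ≠ s} → ι) :
    HasSum (fun i => entry ρ (fillSite s x i) (fillSite s x' i))
      (entry (ptrace (fun t => t ≠ s) ρ) x x') :=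
  (singleSiteEquiv ι s).hasSum_iff.2
    ((hρ.traceable (e := siteEquiv ι fun t => t ≠ s)).hasSum_entry x x')

end Sites

/-! ### Products of series over configurations -/

theorem hasSum_mul_prod {α β : Type*} {f : α → ℂ} {g : β → ℂ} {a b : ℂ} (hf : HasSum f a)
    (hg : HasSum g b) : HasSum (fun p : α × β => f p.1 * g p.2) (a * b) :=
  hf.mul hg (summable_mul_of_summable_norm hf.summable.norm hg.summable.norm)

theorem hasSum_prod_fin {ι : Type*} {n : ℕ} (f : Fin n → ι → ℂ) (a : Fin n → ℂ)
    (h : ∀ i, HasSum (f i) (a i)) :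
    HasSum (fun x : Fin n → ι => ∏ i, f i (x i)) (∏ i, a i) := by
  induction n with
  | zero =>
    simp
  | succ n ih =>
    have h1 := ih (fun i => f i.succ) (fun i => a i.succ) fun i => h i.succ
    rw [Fin.prod_univ_succ]
    have h2 := hasSum_mul_prod (h 0) h1
    have h3 : (fun x : Fin (n + 1) → ι => ∏ i, f i (x i)) ∘ (Fin.consEquiv fun _ => ι) =
        fun p : ι × (Fin n → ι) => f 0 p.1 * ∏ i : Fin n, f i.succ (p.2 i) := by
      funext p
      simp [Fin.prod_univ_succ, Fin.consEquiv]
    rw [← h3] at h2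
    exact (Equiv.hasSum_iff (Fin.consEquiv fun _ : Fin (n + 1) => ι)).1 h2

/-! ### Hybrid antisymmetrized products -/

section Hybrid

variable {ι H : Type*} [NormedAddCommGroup H] [InnerProductSpace ℂ H] {n : ℕ}

theorem inner_prodVec (b : HilbertBasis ι ℂ H) (v w : Fin n → H) :
    inner ℂ (prodVec b v) (prodVec b w) = ∏ i, inner ℂ (v i) (w i) := by
  refine (lp.hasSum_inner (𝕜 := ℂ) (prodVec b v) (prodVec b w)).unique ?_
  have := hasSum_prod_fin (fun i j => inner ℂ (v i) (b j) * inner ℂ (b j) (w i)) _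
    fun i => b.hasSum_inner_mul_inner (v i) (w i)
  have h2 : (fun x => inner ℂ (prodVec b v x) (prodVec b w x)) = fun x : Fin n → ι =>
      ∏ i, inner ℂ (v i) (b (x i)) * inner ℂ (b (x i)) (w i) := by
    funext x
    change (∏ i, inner ℂ (b (x i)) (w i)) * (starRingEnd ℂ) (∏ i, inner ℂ (b (x i)) (v i)) = _
    rw [map_prod, mul_comm, ← Finset.prod_mul_distrib]
    simp only [inner_conj_symm]
  rw [h2]
  exact this

/-- The antisymmetrized product in which the site `i` carries the family `χ i`. -/
def hybrid (b : HilbertBasis ι ℂ H) (χ : Fin n → Fin n → H) : TensorPow ι (Fin n) :=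
  ((Real.sqrt (n.factorial : ℝ))⁻¹ : ℂ) •
    ∑ τ : Equiv.Perm (Fin n), ((Equiv.Perm.sign τ : ℤ) : ℂ) • prodVec b fun i => χ i (τ i)

theorem slater_eq_hybrid (b : HilbertBasis ι ℂ H) (ψ : Fin n → H) :
    slater b ψ = hybrid b fun _ => ψ := rfl

theorem hybrid_apply (b : HilbertBasis ι ℂ H) (χ : Fin n → Fin n → H) (x : Fin n → ι) :
    hybrid b χ x = ((Real.sqrt (n.factorial : ℝ))⁻¹ : ℂ) *
      ∑ τ : Equiv.Perm (Fin n), ((Equiv.Perm.sign τ : ℤ) : ℂ) *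
        ∏ i, inner ℂ (b (x i)) (χ i (τ i)) := by
  rw [hybrid, lp.coeFn_smul, Pi.smul_apply, lp.coeFn_sum, Finset.sum_apply]
  rfl

/-- The Leibniz formula. The determinant gives both antisymmetry in the sites and the effect of
mixing the family by a matrix. -/
theorem slater_apply (b : HilbertBasis ι ℂ H) (ψ : Fin n → H) (x : Fin n → ι) :
    slater b ψ x = ((Real.sqrt (n.factorial : ℝ))⁻¹ : ℂ) *
      (Matrix.of fun i j => inner ℂ (b (x i)) (ψ j)).det := by
  rw [slater_eq_hybrid, hybrid_apply, ← Matrix.det_transpose, Matrix.det_apply']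
  simp

theorem slater_comp_perm (b : HilbertBasis ι ℂ H) (ψ : Fin n → H) (x : Fin n → ι)
    (π : Equiv.Perm (Fin n)) :
    slater b ψ (x ∘ π) = ((Equiv.Perm.sign π : ℤ) : ℂ) * slater b ψ x := by
  rw [slater_apply, slater_apply]
  have := Matrix.det_permute π (Matrix.of fun i j => inner ℂ (b (x i)) (ψ j))
  rw [mul_left_comm, ← this]
  rfl

/-- By symmetry the sum is the same at every site, so it equals its average over the sites; the
existence of `s` makes `n` nonzero. -/
theorem sum_perm_apply (f : Fin n → ℂ) (s : Fin n) :
    ∑ τ : Equiv.Perm (Fin n), f (τ s) = n.factorial * ((1 / (n : ℂ)) * ∑ i, f i) := by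
  have h1 : ∀ t, ∑ τ : Equiv.Perm (Fin n), f (τ t) = ∑ τ : Equiv.Perm (Fin n), f (τ s) := by
    intro t
    refine Fintype.sum_equiv (Equiv.mulRight (Equiv.swap s t)) _ _ fun τ => ?_
    simp
  have h2 : ∑ t, ∑ τ : Equiv.Perm (Fin n), f (τ t) = n.factorial * ∑ i, f i := by
    rw [Finset.sum_comm]
    have : ∀ τ : Equiv.Perm (Fin n), ∑ t, f (τ t) = ∑ i, f i := fun τ => Equiv.sum_comp τ f
    simp [this, Fintype.card_perm]
  simp only [h1] at h2
  have hn : (n : ℂ) ≠ 0 := Nat.cast_ne_zero.2 s.pos.ne'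
  rw [mul_left_comm, ← h2]
  simp [hn]

/-- The inner product of two hybrids which differ only at the site `s`. -/
theorem inner_hybrid (b : HilbertBasis ι ℂ H) {χ χ' : Fin n → Fin n → H}
    (hχ : ∀ i, Orthonormal ℂ (χ i)) (s : Fin n) (h : ∀ t, t ≠ s → χ t = χ' t) :
    inner ℂ (hybrid b χ) (hybrid b χ') =
      (1 / (n : ℂ)) * ∑ i, inner ℂ (χ s i) (χ' s i) := by
  -- Permutations that agree off `s` agree at `s` too. Distinct ones therefore differ at some `t ≠
  -- s`, where `χ t = χ' t` is orthonormal.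
  have key : ∀ τ τ' : Equiv.Perm (Fin n), τ ≠ τ' →
      ∏ i, inner ℂ (χ i (τ i)) (χ' i (τ' i)) = 0 := by
    intro τ τ' hne
    obtain ⟨t, hts, ht⟩ : ∃ t, t ≠ s ∧ τ t ≠ τ' t := by
      by_contra! hc
      refine hne (Equiv.ext fun t => ?_)
      by_cases hts : t = s
      · subst hts
        by_contra hd
        obtain ⟨r, hr⟩ := τ'.surjective (τ t)
        have hrt : r ≠ t := fun h => hd (by rw [← hr, h])
        exact hrt (τ.injective ((hc r hrt).trans hr))
      · exact hc t hts
    refine Finset.prod_eq_zero (Finset.mem_univ t) ?_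
    rw [← h t hts]
    exact (hχ t).2 ht
  have diag : ∀ τ : Equiv.Perm (Fin n), ∏ i, inner ℂ (χ i (τ i)) (χ' i (τ i)) =
      inner ℂ (χ s (τ s)) (χ' s (τ s)) := by
    intro τ
    refine Finset.prod_eq_single s (fun t _ hts => ?_) (by simp)
    rw [← h t hts, inner_self_eq_norm_sq_to_K, (hχ t).1]
    simp
  have hsum : inner ℂ (∑ τ : Equiv.Perm (Fin n),
      ((Equiv.Perm.sign τ : ℤ) : ℂ) • prodVec b fun i => χ i (τ i))
      (∑ τ : Equiv.Perm (Fin n), ((Equiv.Perm.sign τ : ℤ) : ℂ) • prodVec b fun i => χ' i (τ i)) =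
      ∑ τ : Equiv.Perm (Fin n), inner ℂ (χ s (τ s)) (χ' s (τ s)) := by
    rw [sum_inner]
    refine Finset.sum_congr rfl fun τ _ => ?_
    rw [inner_sum, Finset.sum_eq_single τ]
    · rw [inner_smul_left, inner_smul_right, inner_prodVec, diag, ← mul_assoc]
      have : (starRingEnd ℂ) ((Equiv.Perm.sign τ : ℤ) : ℂ) * ((Equiv.Perm.sign τ : ℤ) : ℂ) = 1 := by
        rcases Int.units_eq_one_or (Equiv.Perm.sign τ) with h | h <;> simp [h]
      rw [this, one_mul]
    · intro τ' _ hne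
      rw [inner_smul_left, inner_smul_right, inner_prodVec, key τ τ' hne.symm]
      simp
    · simp
  rw [hybrid, hybrid, inner_smul_left, inner_smul_right, hsum,
    sum_perm_apply (fun a => inner ℂ (χ s a) (χ' s a)) s, ← mul_assoc, ← mul_assoc]
  have hf : (Real.sqrt (n.factorial : ℝ) : ℂ) * (Real.sqrt (n.factorial : ℝ) : ℂ) = n.factorial := by
    rw [← Complex.ofReal_mul, Real.mul_self_sqrt (by positivity)]
    simp
  have hf0 : (n.factorial : ℂ) ≠ 0 := by exact_mod_cast n.factorial_ne_zero
  have : (starRingEnd ℂ) ((Real.sqrt (n.factorial : ℝ) : ℂ)⁻¹) *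
      (Real.sqrt (n.factorial : ℝ) : ℂ)⁻¹ * n.factorial = 1 := by
    rw [map_inv₀, Complex.conj_ofReal, ← mul_inv, hf, inv_mul_cancel₀ hf0]
  rw [this, one_mul]

/-- The case `χ = χ'` of `inner_hybrid`; the site `s` only witnesses `n > 0`. -/
theorem norm_hybrid (b : HilbertBasis ι ℂ H) {χ : Fin n → Fin n → H}
    (hχ : ∀ i, Orthonormal ℂ (χ i)) (s : Fin n) : ‖hybrid b χ‖ = 1 := by
  have h1 := inner_hybrid b hχ s (fun _ _ => rfl : ∀ t, t ≠ s → χ t = χ t)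
  have h2 : ∀ i, inner ℂ (χ s i) (χ s i) = 1 := by
    intro i
    rw [inner_self_eq_norm_sq_to_K, (hχ s).1]
    simp
  have hn : (n : ℂ) ≠ 0 := Nat.cast_ne_zero.2 s.pos.ne'
  simp only [h2, Finset.sum_const, Finset.card_univ, Fintype.card_fin, nsmul_eq_mul, mul_one,
    one_div, inv_mul_cancel₀ hn] at h1
  rw [inner_self_eq_norm_sq_to_K] at h1
  have h3 : ‖hybrid b χ‖ ^ 2 = 1 := by
    have h1 : ((‖hybrid b χ‖ : ℂ)) ^ 2 = 1 := h1
    rw [← Complex.ofReal_pow] at h1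
    exact Complex.ofReal_eq_one.1 h1
  exact (pow_eq_one_iff_of_nonneg (norm_nonneg _) two_ne_zero).1 h3

theorem norm_slater (b : HilbertBasis ι ℂ H) {ψ : Fin n → H} (hψ : Orthonormal ℂ ψ)
    (hn : 0 < n) : ‖slater b ψ‖ = 1 :=
  norm_hybrid b (fun _ => hψ) ⟨0, hn⟩

/-- The coefficient of a term of a hybrid off the site `s`. -/
def offSiteCoeff (b : HilbertBasis ι ℂ H) (χ : Fin n → Fin n → H) (s : Fin n)
    (x : {t // t ≠ s} → ι) (τ : Equiv.Perm (Fin n)) : ℂ :=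
  ((Real.sqrt (n.factorial : ℝ))⁻¹ : ℂ) * (((Equiv.Perm.sign τ : ℤ) : ℂ) *
    ∏ t : {t // t ≠ s}, inner ℂ (b (x t)) (χ t (τ t)))

/-- With the other sites frozen, the coefficients at `s` are those of a single vector of `H`, so
Parseval computes the trace over `s`. -/
theorem hybrid_fillSite (b : HilbertBasis ι ℂ H) (χ : Fin n → Fin n → H) (s : Fin n)
    (x : {t // t ≠ s} → ι) (i : ι) :
    hybrid b χ (fillSite s x i) =
      inner ℂ (b i) (∑ τ : Equiv.Perm (Fin n), offSiteCoeff b χ s x τ • χ s (τ s)) := by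
  rw [hybrid_apply, inner_sum, Finset.mul_sum]
  refine Finset.sum_congr rfl fun τ _ => ?_
  rw [inner_smul_right, offSiteCoeff, Fintype.prod_eq_mul_prod_subtype_ne _ s, fillSite_self]
  simp only [fillSite_ne]
  ring

/-- After Parseval, orthonormality of `χ s` leaves a Kronecker delta. As `offSiteCoeff` involves
only the other sites, `χ s` disappears. -/
theorem entry_ptrace_ne_hybrid (b : HilbertBasis ι ℂ H) {χ : Fin n → Fin n → H}
    (hχ : ∀ i, Orthonormal ℂ (χ i)) (s : Fin n) (x x' : {t // t ≠ s} → ι) :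
    entry (ptrace (fun t => t ≠ s) (pureState (hybrid b χ))) x x' =
      ∑ τ' : Equiv.Perm (Fin n), ∑ τ : Equiv.Perm (Fin n),
        star (offSiteCoeff b χ s x' τ') * (offSiteCoeff b χ s x τ * if τ' s = τ s then 1 else 0) := by
  have h1 := hasSum_entry_ptrace_ne (pureState_isDensity (norm_hybrid b hχ s)) s x x'
  have h2 := b.hasSum_inner_mul_inner
    (∑ τ : Equiv.Perm (Fin n), offSiteCoeff b χ s x' τ • χ s (τ s))
    (∑ τ : Equiv.Perm (Fin n), offSiteCoeff b χ s x τ • χ s (τ s))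
  have h3 : (fun i => entry (pureState (hybrid b χ)) (fillSite s x i) (fillSite s x' i)) =
      fun i => inner ℂ (∑ τ : Equiv.Perm (Fin n), offSiteCoeff b χ s x' τ • χ s (τ s)) (b i) *
        inner ℂ (b i) (∑ τ : Equiv.Perm (Fin n), offSiteCoeff b χ s x τ • χ s (τ s)) := by
    funext i
    rw [pureState, entry_rankOne, hybrid_fillSite, hybrid_fillSite, mul_comm,
      ← inner_conj_symm _ (b i)]
    rfl
  rw [h3] at h1
  rw [h1.unique h2, sum_inner]
  refine Finset.sum_congr rfl fun τ' _ => ?_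
  rw [inner_sum]
  refine Finset.sum_congr rfl fun τ _ => ?_
  rw [inner_smul_left, inner_smul_right, orthonormal_iff_ite.1 (hχ s)]
  rfl

/-- The reduced state off the site `s` does not depend on the family carried by `s`. -/
theorem ptrace_ne_hybrid_congr (b : HilbertBasis ι ℂ H) {χ χ' : Fin n → Fin n → H}
    (hχ : ∀ i, Orthonormal ℂ (χ i)) (hχ' : ∀ i, Orthonormal ℂ (χ' i)) (s : Fin n)
    (h : ∀ t, t ≠ s → χ t = χ' t) :
    ptrace (fun t => t ≠ s) (pureState (hybrid b χ)) =
      ptrace (fun t => t ≠ s) (pureState (hybrid b χ')) := by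
  have hc : offSiteCoeff b χ s = offSiteCoeff b χ' s := by
    funext x τ
    rw [offSiteCoeff, offSiteCoeff]
    congr 2
    exact Finset.prod_congr rfl fun t _ => by rw [h t t.2]
  refine ext_entry fun x x' => ?_
  rw [entry_ptrace_ne_hybrid b hχ, entry_ptrace_ne_hybrid b hχ', hc]

end Hybrid

/-! ### Differences of two pure states -/

section PureStates

/-- For unit vectors `u`, `v` with real overlap `α`, the vectors `a u + b v` and `b u + a v`
diagonalize `|u⟩⟨u| - |v⟩⟨v|`. The first equation normalizes them; the second gives the eigenvalues
`±√(1 - α²)`. -/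
theorem exists_mix_coeffs {α : ℝ} (h0 : 0 ≤ α) (h1 : α < 1) :
    ∃ a b : ℝ, a ^ 2 + b ^ 2 + 2 * a * b * α = 1 ∧
      Real.sqrt (1 - α ^ 2) * (a ^ 2 - b ^ 2) = 1 := by
  set r := Real.sqrt (1 + α) with hr
  set t := Real.sqrt (1 - α) with ht
  have hr2 : r ^ 2 = 1 + α := Real.sq_sqrt (by linarith)
  have ht2 : t ^ 2 = 1 - α := Real.sq_sqrt (by linarith)
  have hr0 : 0 < r := Real.sqrt_pos.2 (by linarith)
  have ht0 : 0 < t := Real.sqrt_pos.2 (by linarith)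
  have hc : Real.sqrt (1 - α ^ 2) = r * t := by
    rw [hr, ht, ← Real.sqrt_mul (by linarith)]
    congr 1
    ring
  -- These are the coefficients of `(u + v)/(2r) + (u - v)/(2t)`, where `u ± v` are orthogonal with
  -- norms `√2 r` and `√2 t`.
  refine ⟨(r⁻¹ + t⁻¹) / 2, (r⁻¹ - t⁻¹) / 2, ?_, ?_⟩
  · have h3 : r⁻¹ ^ 2 * (1 + α) = 1 := by rw [← hr2]; field_simp
    have h4 : t⁻¹ ^ 2 * (1 - α) = 1 := by rw [← ht2]; field_simp
    linear_combination (1 / 2) * h3 + (1 / 2) * h4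
  · rw [hc]
    field_simp
    ring

variable {E : Type*} [NormedAddCommGroup E] [InnerProductSpace ℂ E]

theorem norm_mix {u v : E} (hu : ‖u‖ = 1) (hv : ‖v‖ = 1) {α a b : ℝ} (h : inner ℂ u v = (α : ℂ))
    (hab : a ^ 2 + b ^ 2 + 2 * a * b * α = 1) : ‖(a : ℂ) • u + (b : ℂ) • v‖ = 1 := by
  have h1 : ‖(a : ℂ) • u + (b : ℂ) • v‖ ^ 2 = 1 := by
    rw [@norm_add_sq ℂ, inner_smul_left, inner_smul_right, h, norm_smul, norm_smul, hu, hv]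
    rw [Complex.conj_ofReal, ← Complex.ofReal_mul, ← Complex.ofReal_mul]
    simp only [RCLike.re_to_complex, Complex.ofReal_re, Complex.norm_real, mul_one,
      Real.norm_eq_abs, sq_abs]
    linarith
  exact (pow_eq_one_iff_of_nonneg (norm_nonneg _) two_ne_zero).1 h1

theorem rankOne_smul_smul {ω : ℂ} (hω : ‖ω‖ = 1) (v : E) :
    InnerProductSpace.rankOne ℂ (ω • v) (ω • v) = InnerProductSpace.rankOne ℂ v v := by
  ext w
  rw [InnerProductSpace.rankOne_apply, InnerProductSpace.rankOne_apply, inner_smul_left,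
    smul_smul, mul_right_comm, Complex.conj_mul', hω]
  simp

/-- The spectral decomposition of the difference of two pure states. -/
theorem exists_rankOne_sub_eq {u v : E} (hu : ‖u‖ = 1) (hv : ‖v‖ = 1) :
    ∃ e f : E, ‖e‖ = 1 ∧ ‖f‖ = 1 ∧
      InnerProductSpace.rankOne ℂ u u - InnerProductSpace.rankOne ℂ v v =
        (Real.sqrt (1 - ‖inner ℂ u v‖ ^ 2) : ℂ) •
          (InnerProductSpace.rankOne ℂ e e - InnerProductSpace.rankOne ℂ f f) ∧
      (Real.sqrt (1 - ‖inner ℂ u v‖ ^ 2) = 0 → e = f) := by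
  -- A phase on `v` makes the overlap real and nonnegative without changing the pure state.
  obtain ⟨ω, hω, hz⟩ := RCLike.exists_norm_eq_mul_self (inner ℂ u v)
  set α := ‖inner ℂ u v‖ with hα
  rw [← rankOne_smul_smul hω v]
  have hv' : ‖ω • v‖ = 1 := by rw [norm_smul, hω, hv, one_mul]
  have hi : inner ℂ u (ω • v) = (α : ℂ) := by
    rw [inner_smul_right]
    exact hz.symm
  generalize ω • v = v' at hv' hi
  have h0 : 0 ≤ α := norm_nonneg _
  have h1 : α ≤ 1 := by
    have := norm_inner_le_norm (𝕜 := ℂ) u v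
    rwa [hu, hv, one_mul] at this
  rcases h1.lt_or_eq with h1 | h1
  · obtain ⟨a, b, hab, hc⟩ := exists_mix_coeffs h0 h1
    refine ⟨(a : ℂ) • u + (b : ℂ) • v', (b : ℂ) • u + (a : ℂ) • v',
      norm_mix hu hv' hi hab, norm_mix hu hv' hi (by linarith), ?_, ?_⟩
    -- The cross terms of the two projections cancel, leaving `(a² - b²)(|u⟩⟨u| - |v⟩⟨v|)`.
    · have hc' : (Real.sqrt (1 - α ^ 2) : ℂ) * ((a : ℂ) ^ 2 - (b : ℂ) ^ 2) = 1 := by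
        exact_mod_cast hc
      ext w
      simp only [sub_apply, smul_apply,
        InnerProductSpace.rankOne_apply, inner_add_left, inner_smul_left, Complex.conj_ofReal]
      rw [← one_smul ℂ (inner ℂ u w • u - inner ℂ v' w • v'), ← hc']
      module
    · intro h
      rw [h, zero_mul] at hc
      exact absurd hc zero_ne_one
  · have huv : u = v' := by
      rw [← inner_eq_one_iff_of_norm_eq_one (𝕜 := ℂ) hu hv', hi, h1]
      simp
    subst huv
    refine ⟨u, u, hu, hu, ?_, fun _ => rfl⟩
    simp

end PureStates

/-! ### The bound for fixed families -/

section SlaterBound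

variable {ι H : Type*} [NormedAddCommGroup H] [InnerProductSpace ℂ H] {n : ℕ}

/-- The coupling cost of two pure states with the same reduced state off a site. -/
theorem exists_density_sub_eq {S : Type*} [DecidableEq S] {u v : TensorPow ι S} (hu : ‖u‖ = 1)
    (hv : ‖v‖ = 1) (s : S)
    (h : ptrace (fun t => t ≠ s) (pureState u) = ptrace (fun t => t ≠ s) (pureState v)) :
    ∃ ρ σ : TensorPow ι S →L[ℂ] TensorPow ι S, IsDensity ρ ∧ IsDensity σ ∧
      ptrace (fun t => t ≠ s) ρ = ptrace (fun t => t ≠ s) σ ∧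
      pureState u - pureState v = (Real.sqrt (1 - ‖inner ℂ u v‖ ^ 2) : ℂ) • (ρ - σ) := by
  obtain ⟨e, f, he, hf, heq, h0⟩ := exists_rankOne_sub_eq hu hv
  refine ⟨_, _, isDensity_rankOne he, isDensity_rankOne hf, ?_, heq⟩
  -- A zero coefficient would make the identity say nothing about the two reduced states, so `e = f`
  -- is used there; otherwise the coefficient is divided out.
  by_cases hc : Real.sqrt (1 - ‖inner ℂ u v‖ ^ 2) = 0
  · rw [h0 hc]
  have hce : (Real.sqrt (1 - ‖inner ℂ u v‖ ^ 2) : ℂ) ≠ 0 := Complex.ofReal_ne_zero.2 hc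
  have h1 := congrArg (partialTrace (siteEquiv ι fun t => t ≠ s)) heq
  rw [partialTrace_sub (isDensity_rankOne hu).traceable (isDensity_rankOne hv).traceable,
    partialTrace_smul ((isDensity_rankOne he).traceable.sub (isDensity_rankOne hf).traceable),
    partialTrace_sub (isDensity_rankOne he).traceable (isDensity_rankOne hf).traceable] at h1
  have h2 : partialTrace (siteEquiv ι fun t => t ≠ s) (InnerProductSpace.rankOne ℂ u u) =
    partialTrace (siteEquiv ι fun t => t ≠ s) (InnerProductSpace.rankOne ℂ v v) := h
  rw [h2, sub_self, eq_comm, smul_eq_zero] at h1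
  exact sub_eq_zero.1 (h1.resolve_left hce)

/-- The first `k` sites carry `φ`, the others carry `ψ`. -/
def hybridFamily (ψ φ : Fin n → H) (k : ℕ) : Fin n → Fin n → H :=
  fun i => if (i : ℕ) < k then φ else ψ

theorem w1Norm_slater_le (b : HilbertBasis ι ℂ H) {ψ φ : Fin n → H} (hψ : Orthonormal ℂ ψ)
    (hφ : Orthonormal ℂ φ) :
    w1Norm (pureState (slater b ψ) - pureState (slater b φ)) ≤
      ENNReal.ofReal
        (n * Real.sqrt (1 - ‖(1 / (n : ℂ)) * ∑ i, inner ℂ (ψ i) (φ i)‖ ^ 2)) := by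
  have hχ : ∀ k i, Orthonormal ℂ (hybridFamily ψ φ k i) := by
    intro k i
    unfold hybridFamily
    split_ifs <;> assumption
  have hne : ∀ s t : Fin n, t ≠ s →
      hybridFamily ψ φ s t = hybridFamily ψ φ (s + 1) t := by
    intro s t hts
    have : ((t : ℕ) < s) ↔ ((t : ℕ) < s + 1) := by
      have : (t : ℕ) ≠ s := fun h => hts (Fin.ext h)
      omega
    simp only [hybridFamily, this]
  have key : ∀ s : Fin n, ∃ ρ σ : TensorPow ι (Fin n) →L[ℂ] TensorPow ι (Fin n),
      IsDensity ρ ∧ IsDensity σ ∧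
      ptrace (fun t => t ≠ s) ρ = ptrace (fun t => t ≠ s) σ ∧
      pureState (hybrid b (hybridFamily ψ φ s)) - pureState (hybrid b (hybridFamily ψ φ (s + 1))) =
        (Real.sqrt (1 - ‖(1 / (n : ℂ)) * ∑ i, inner ℂ (ψ i) (φ i)‖ ^ 2) : ℂ) • (ρ - σ) := by
    intro s
    have h1 := exists_density_sub_eq (norm_hybrid b (hχ s) s) (norm_hybrid b (hχ (s + 1)) s) s
      (ptrace_ne_hybrid_congr b (hχ s) (hχ (s + 1)) s (hne s))
    rw [inner_hybrid b (hχ s) s (hne s)] at h1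
    have h2 : hybridFamily ψ φ s s = ψ := by simp [hybridFamily]
    have h3 : hybridFamily ψ φ (s + 1) s = φ := by simp [hybridFamily]
    rw [h2, h3] at h1
    exact h1
  choose ρ σ hρ hσ hp heq using key
  refine sInf_le ⟨fun _ =>
    Real.sqrt (1 - ‖(1 / (n : ℂ)) * ∑ i, inner ℂ (ψ i) (φ i)‖ ^ 2), ρ, σ,
    fun _ => Real.sqrt_nonneg _, hρ, hσ, hp, ?_, ?_⟩
  -- The links telescope from threshold `0`, where every site carries `ψ`, to threshold `n`, where
  -- every site carries `φ`.
  · rw [← Finset.sum_congr rfl fun s _ => heq s,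
      Fin.sum_univ_eq_sum_range (fun k => pureState (hybrid b (hybridFamily ψ φ k)) -
        pureState (hybrid b (hybridFamily ψ φ (k + 1)))) n, Finset.sum_range_sub']
    have h0 : hybridFamily ψ φ 0 = fun _ => ψ := by
      funext i
      simp [hybridFamily]
    have hn : hybridFamily ψ φ n = fun _ => φ := by
      funext i
      simp [hybridFamily]
    rw [h0, hn]
    rfl
  · simp

end SlaterBound

/-! ### Stabilizers as unitary matrices; attainment of the maximum -/

section Stabilizer

variable {H : Type*} [NormedAddCommGroup H] [InnerProductSpace ℂ H] {n : ℕ}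

/-- The family `∑ₗ A l i • ψₗ`. -/
def mixFamily (ψ : Fin n → H) (A : Matrix (Fin n) (Fin n) ℂ) : Fin n → H :=
  fun i => ∑ l, A l i • ψ l

/-- The operator with matrix `A` on the span of `ψ` which vanishes on its orthogonal complement. -/
def matrixOp (ψ : Fin n → H) (A : Matrix (Fin n) (Fin n) ℂ) : H →L[ℂ] H :=
  ∑ j, InnerProductSpace.rankOne ℂ (mixFamily ψ A j) (ψ j)

theorem matrixOp_apply (ψ : Fin n → H) (A : Matrix (Fin n) (Fin n) ℂ) (w : H) :
    matrixOp ψ A w = ∑ j, inner ℂ (ψ j) w • mixFamily ψ A j := by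
  simp [matrixOp]

theorem mixFamily_one (ψ : Fin n → H) : mixFamily ψ 1 = ψ := by
  funext i
  simp [mixFamily, Matrix.one_apply]

theorem matrixOp_one (ψ : Fin n → H) : matrixOp ψ 1 = oneParticleProj ψ := by
  rw [matrixOp, mixFamily_one, oneParticleProj]

theorem matrixOp_apply_self {ψ : Fin n → H} (hψ : Orthonormal ℂ ψ)
    (A : Matrix (Fin n) (Fin n) ℂ) (i : Fin n) : matrixOp ψ A (ψ i) = mixFamily ψ A i := by
  simp [matrixOp_apply, orthonormal_iff_ite.1 hψ]

theorem matrixOp_mul {ψ : Fin n → H} (hψ : Orthonormal ℂ ψ) (A B : Matrix (Fin n) (Fin n) ℂ) :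
    matrixOp ψ A * matrixOp ψ B = matrixOp ψ (A * B) := by
  ext w
  rw [mul_apply_eq_comp, matrixOp_apply ψ B, matrixOp_apply ψ (A * B), map_sum]
  refine Finset.sum_congr rfl fun j _ => ?_
  rw [map_smul]
  congr 1
  simp only [mixFamily, map_sum, map_smul, matrixOp_apply_self hψ, Matrix.mul_apply,
    Finset.smul_sum, Finset.sum_smul]
  rw [Finset.sum_comm]
  refine Finset.sum_congr rfl fun l _ => Finset.sum_congr rfl fun m _ => ?_
  rw [smul_smul, mul_comm]

/-- The unitary with matrix `A` on the span of `ψ`, the identity on its orthogonal complement. -/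
def extendUnitary (ψ : Fin n → H) (A : Matrix (Fin n) (Fin n) ℂ) : H →L[ℂ] H :=
  matrixOp ψ A + (1 - matrixOp ψ 1)

theorem extendUnitary_apply {ψ : Fin n → H} (hψ : Orthonormal ℂ ψ)
    (A : Matrix (Fin n) (Fin n) ℂ) (i : Fin n) : extendUnitary ψ A (ψ i) = mixFamily ψ A i := by
  simp [extendUnitary, matrixOp_apply_self hψ, mixFamily_one]

theorem extendUnitary_mul {ψ : Fin n → H} (hψ : Orthonormal ℂ ψ)
    (A B : Matrix (Fin n) (Fin n) ℂ) :
    extendUnitary ψ A * extendUnitary ψ B = extendUnitary ψ (A * B) := by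
  simp only [extendUnitary, mul_add, add_mul, mul_sub, sub_mul, matrixOp_mul hψ, mul_one, one_mul]
  abel

theorem extendUnitary_one (ψ : Fin n → H) : extendUnitary ψ 1 = 1 := by
  simp [extendUnitary]

variable {ι : Type*}

/-- Mixing multiplies the coefficient matrix by `A`, hence the Slater vector by `det A`, a phase. -/
theorem pureState_slater_mixFamily (b : HilbertBasis ι ℂ H) (ψ : Fin n → H)
    {A : Matrix (Fin n) (Fin n) ℂ} (hA : A ∈ Matrix.unitaryGroup (Fin n) ℂ) :
    pureState (slater b (mixFamily ψ A)) = pureState (slater b ψ) := by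
  have h1 : slater b (mixFamily ψ A) = A.det • slater b ψ := by
    ext x
    rw [lp.coeFn_smul, Pi.smul_apply, slater_apply, slater_apply, smul_eq_mul, mul_left_comm,
      mul_comm A.det, ← Matrix.det_mul]
    congr 2
    ext i j
    simp [Matrix.mul_apply, mixFamily, mul_comm]
  rw [h1]
  exact rankOne_smul_smul (CStarRing.norm_of_mem_unitary (Matrix.det_of_mem_unitary hA)) _

variable [CompleteSpace H]

theorem star_matrixOp (ψ : Fin n → H) (A : Matrix (Fin n) (Fin n) ℂ) :
    star (matrixOp ψ A) = matrixOp ψ (star A) := by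
  rw [ContinuousLinearMap.star_eq_adjoint]
  refine (ContinuousLinearMap.eq_adjoint_iff _ _).2 (fun v w => ?_) |>.symm
  simp only [matrixOp_apply, mixFamily, sum_inner, inner_sum, inner_smul_left, inner_smul_right,
    Matrix.star_apply, Finset.mul_sum, inner_conj_symm]
  rw [Finset.sum_comm]
  refine Finset.sum_congr rfl fun l _ => Finset.sum_congr rfl fun m _ => ?_
  simp
  ring

theorem star_extendUnitary (ψ : Fin n → H) (A : Matrix (Fin n) (Fin n) ℂ) :
    star (extendUnitary ψ A) = extendUnitary ψ (star A) := by
  simp [extendUnitary, star_matrixOp]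

theorem extendUnitary_mem_stabilizer {ψ : Fin n → H} (hψ : Orthonormal ℂ ψ)
    {A : Matrix (Fin n) (Fin n) ℂ} (hA : A ∈ Matrix.unitaryGroup (Fin n) ℂ) :
    extendUnitary ψ A ∈ stabilizer ψ := by
  have h1 : star A * A = 1 := Matrix.mem_unitaryGroup_iff'.1 hA
  have h2 : A * star A = 1 := Matrix.mem_unitaryGroup_iff.1 hA
  refine ⟨Unitary.mem_iff.2 ⟨?_, ?_⟩, ?_⟩
  · rw [star_extendUnitary, extendUnitary_mul hψ, h1, extendUnitary_one]
  · rw [star_extendUnitary, extendUnitary_mul hψ, h2, extendUnitary_one]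
  · rw [star_extendUnitary, ← matrixOp_one]
    simp only [extendUnitary, mul_add, add_mul, mul_sub, sub_mul, matrixOp_mul hψ, mul_one,
      one_mul, h2]
    abel

/-- `V` commutes with the projection onto the span of `ψ`, so it preserves that span; its matrix
there is unitary because `V` preserves inner products. -/
theorem exists_mixFamily_of_mem_stabilizer {ψ : Fin n → H} (hψ : Orthonormal ℂ ψ)
    {V : H →L[ℂ] H} (hV : V ∈ stabilizer ψ) :
    ∃ A ∈ Matrix.unitaryGroup (Fin n) ℂ, ∀ i, V (ψ i) = mixFamily ψ A i := by
  obtain ⟨hu, hK⟩ := hV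
  have hcomm : V * oneParticleProj ψ = oneParticleProj ψ * V := by
    conv_rhs => rw [← hK]
    rw [mul_assoc _ (star V) V, (Unitary.mem_iff.1 hu).1, mul_one]
  have hmix : ∀ i, V (ψ i) =
      mixFamily ψ (Matrix.of fun l i => inner ℂ (ψ l) (V (ψ i))) i := by
    intro i
    have h1 := congrArg (fun T : H →L[ℂ] H => T (ψ i)) hcomm
    simp only [mul_apply_eq_comp, ← matrixOp_one, matrixOp_apply_self hψ,
      mixFamily_one] at h1
    rw [matrixOp_apply, mixFamily_one] at h1
    exact h1
  refine ⟨_, Matrix.mem_unitaryGroup_iff'.2 ?_, hmix⟩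
  ext i j
  have h1 : inner ℂ (V (ψ i)) (V (ψ j)) = inner ℂ (ψ i) (ψ j) :=
    ContinuousLinearMap.inner_map_map_of_mem_unitary hu _ _
  rw [orthonormal_iff_ite.1 hψ] at h1
  rw [Matrix.one_apply, ← h1, Matrix.mul_apply]
  conv_rhs => rw [hmix j, mixFamily, inner_sum]
  refine Finset.sum_congr rfl fun l _ => ?_
  rw [inner_smul_right, ← inner_conj_symm (V (ψ i)) (ψ l), mul_comm]
  rfl

theorem isCompact_unitaryGroup (n : ℕ) :
    IsCompact (Matrix.unitaryGroup (Fin n) ℂ : Set (Matrix (Fin n) (Fin n) ℂ)) := by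
  have h1 : IsCompact (Set.univ.pi fun _ => Set.univ.pi fun _ => Metric.closedBall 0 1 :
      Set (Fin n → Fin n → ℂ)) :=
    isCompact_univ_pi fun _ => isCompact_univ_pi fun _ => isCompact_closedBall _ _
  refine IsCompact.of_isClosed_subset (X := Matrix (Fin n) (Fin n) ℂ) h1 isClosed_unitary ?_
  intro A hA i _ j _
  simpa using entry_norm_bound_of_unitary hA i j

/-- Overlaps depend on `V` and `U` only through their matrices on the two spans. This reduction
supplies compactness even when `H` is infinite-dimensional. -/
theorem exists_isGreatest_overlaps {ψ φ : Fin n → H} (hψ : Orthonormal ℂ ψ)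
    (hφ : Orthonormal ℂ φ) : ∃ m, IsGreatest (overlaps ψ φ) m := by
  have himage : overlaps ψ φ =
      (fun p : Matrix (Fin n) (Fin n) ℂ × Matrix (Fin n) (Fin n) ℂ =>
        ‖(1 / (n : ℂ)) * ∑ i, inner ℂ (mixFamily ψ p.1 i) (mixFamily φ p.2 i)‖ ^ 2) ''
      ((Matrix.unitaryGroup (Fin n) ℂ : Set (Matrix (Fin n) (Fin n) ℂ)) ×ˢ
        (Matrix.unitaryGroup (Fin n) ℂ : Set (Matrix (Fin n) (Fin n) ℂ))) := by
    ext r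
    constructor
    · rintro ⟨V, hV, U, hU, rfl⟩
      obtain ⟨A, hA, hVA⟩ := exists_mixFamily_of_mem_stabilizer hψ hV
      obtain ⟨B, hB, hUB⟩ := exists_mixFamily_of_mem_stabilizer hφ hU
      exact ⟨(A, B), ⟨hA, hB⟩, by simp only [hVA, hUB]⟩
    · rintro ⟨⟨A, B⟩, ⟨hA, hB⟩, rfl⟩
      refine ⟨_, extendUnitary_mem_stabilizer hψ hA, _, extendUnitary_mem_stabilizer hφ hB, ?_⟩
      simp only [extendUnitary_apply hψ, extendUnitary_apply hφ]
  rw [himage]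
  have hc : IsCompact ((Matrix.unitaryGroup (Fin n) ℂ : Set (Matrix (Fin n) (Fin n) ℂ)) ×ˢ
      (Matrix.unitaryGroup (Fin n) ℂ : Set (Matrix (Fin n) (Fin n) ℂ))) :=
    IsCompact.prod (isCompact_unitaryGroup n) (isCompact_unitaryGroup n)
  refine (hc.image ?_).exists_isGreatest ?_
  · unfold mixFamily
    fun_prop
  · have h1 : (1 : Matrix (Fin n) (Fin n) ℂ) ∈ Matrix.unitaryGroup (Fin n) ℂ := one_mem _
    exact Set.Nonempty.image _ ⟨(1, 1), Set.mk_mem_prod h1 h1⟩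

theorem w1Norm_slater_le_of_mem_overlaps (b : HilbertBasis ι ℂ H) {ψ φ : Fin n → H}
    (hψ : Orthonormal ℂ ψ) (hφ : Orthonormal ℂ φ) {m : ℝ} (hm : m ∈ overlaps ψ φ) :
    w1Norm (pureState (slater b ψ) - pureState (slater b φ)) ≤
      ENNReal.ofReal (n * Real.sqrt (1 - m)) := by
  obtain ⟨V, hV, U, hU, rfl⟩ := hm
  have hstab : ∀ {χ : Fin n → H} {W : H →L[ℂ] H}, Orthonormal ℂ χ → W ∈ stabilizer χ →
      Orthonormal ℂ (fun i => W (χ i)) ∧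
        pureState (slater b fun i => W (χ i)) = pureState (slater b χ) := by
    intro χ W hχ hW
    constructor
    · rw [orthonormal_iff_ite]
      intro i j
      rw [ContinuousLinearMap.inner_map_map_of_mem_unitary hW.1, orthonormal_iff_ite.1 hχ]
    · obtain ⟨A, hA, hWA⟩ := exists_mixFamily_of_mem_stabilizer hχ hW
      rw [funext hWA]
      exact pureState_slater_mixFamily b χ hA
  rw [← (hstab hψ hV).2, ← (hstab hφ hU).2]
  exact w1Norm_slater_le b (hstab hψ hV).1 (hstab hφ hU).1

end Stabilizer

/-! ### Tracing one site out of a representation -/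

section DropSite

variable {ι S S' : Type*} [DecidableEq S] {s₀ : S}

/-- Splitting of the configurations of `S` into those of `S' ≃ S \ {s₀}` and of `s₀`. -/
def dropSite (ι : Type*) (g : S' ≃ {t : S // t ≠ s₀}) : (S' → ι) × ι ≃ (S → ι) where
  toFun p := fillSite s₀ (fun t => p.1 (g.symm t)) p.2
  invFun y := (fun s => y (g s), y s₀)
  left_inv p := by
    ext1
    · funext s
      simp [fillSite_ne]
    · simp [fillSite_self]
  right_inv y := by
    funext t
    by_cases h : t = s₀
    · subst h
      simp [fillSite]
    · simp [fillSite, h]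

variable (g : S' ≃ {t : S // t ≠ s₀})

theorem dropSite_apply (x : S' → ι) (i : ι) :
    dropSite ι g (x, i) = fillSite s₀ (fun t => x (g.symm t)) i := rfl

theorem partialTrace_dropSite_congr {ρ σ : TensorPow ι S →L[ℂ] TensorPow ι S}
    (hρ : IsDensity ρ) (hσ : IsDensity σ)
    (h : ptrace (fun t => t ≠ s₀) ρ = ptrace (fun t => t ≠ s₀) σ) :
    partialTrace (dropSite ι g) ρ = partialTrace (dropSite ι g) σ := by
  have key : ∀ {ρ : TensorPow ι S →L[ℂ] TensorPow ι S}, IsDensity ρ → ∀ x x' : S' → ι,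
      entry (partialTrace (dropSite ι g) ρ) x x' =
        entry (ptrace (fun t => t ≠ s₀) ρ) (fun t => x (g.symm t)) (fun t => x' (g.symm t)) := by
    intro ρ hρ x x'
    have h1 := hρ.traceable.hasSum_entry (e := dropSite ι g) x x'
    exact h1.unique
      (hasSum_entry_ptrace_ne hρ s₀ (fun t => x (g.symm t)) (fun t => x' (g.symm t)))
  exact ext_entry fun x x' => by rw [key hρ, key hσ, h]

variable [DecidableEq S']

/-- One configuration, with `i` at `s₀` and `j` at `g s`, read in two orders of filling. On the
right the inner `i` at `s` is a placeholder: the value at `g s` is never read. -/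
theorem dropSite_fillSite (s : S') (x : {t // t ≠ s} → ι) (i j : ι) :
    dropSite ι g (fillSite s x j, i) =
      fillSite (g s : S) (fun t => dropSite ι g (fillSite s x i, i) t) j := by
  funext t
  by_cases h₀ : t = s₀
  · subst h₀
    have : t ≠ g s := (g s).2.symm
    simp [fillSite, dropSite_apply, this]
  · by_cases h : t = g s
    · subst h
      simp [fillSite, dropSite_apply, (g s).2]
    · have h' : g.symm ⟨t, h₀⟩ ≠ s := by
        intro h'
        rw [Equiv.symm_apply_eq] at h'
        exact h (congrArg Subtype.val h')
      simp [fillSite, dropSite_apply, h, h₀, h']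

theorem injective_dropSite_fillSite (s : S') (x : {t // t ≠ s} → ι) :
    Function.Injective fun p : ι × ι => dropSite ι g (fillSite s x p.1, p.2) := by
  intro p q h
  have h1 := (dropSite ι g).injective h
  rw [Prod.ext_iff] at h1
  refine Prod.ext ?_ h1.2
  simpa [fillSite_self] using congrFun h1.1 s

/-- Partial traces commute: the double series over the values at `s₀` and `g s` converges
absolutely, so it may be summed in either order. -/
theorem hasSum_entry_ptrace_partialTrace {ρ : TensorPow ι S →L[ℂ] TensorPow ι S}
    (hρ : IsDensity ρ) (s : S') (x x' : {t // t ≠ s} → ι) :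
    HasSum (fun i => entry (ptrace (fun t => t ≠ (g s : S)) ρ)
        (fun t => dropSite ι g (fillSite s x i, i) t)
        (fun t => dropSite ι g (fillSite s x' i, i) t))
      (entry (ptrace (fun t => t ≠ s) (partialTrace (dropSite ι g) ρ)) x x') := by
  have hsum := (hρ.summable_entry (injective_dropSite_fillSite g s x)
    (injective_dropSite_fillSite g s x')).hasSum
  have h1 := hsum.prod_fiberwise fun j =>
    hρ.traceable.hasSum_entry (e := dropSite ι g) (fillSite s x j) (fillSite s x' j)
  have h2 := hasSum_entry_ptrace_ne (hρ.partialTrace (e := dropSite ι g)) s x x'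
  rw [h2.unique h1]
  refine ((Equiv.prodComm ι ι).hasSum_iff.2 hsum).prod_fiberwise fun i => ?_
  have h3 := hasSum_entry_ptrace_ne hρ (g s : S)
    (fun t => dropSite ι g (fillSite s x i, i) t) (fun t => dropSite ι g (fillSite s x' i, i) t)
  simp only [← dropSite_fillSite] at h3
  exact h3

theorem ptrace_partialTrace_dropSite_congr {ρ σ : TensorPow ι S →L[ℂ] TensorPow ι S}
    (hρ : IsDensity ρ) (hσ : IsDensity σ) (s : S')
    (h : ptrace (fun t => t ≠ (g s : S)) ρ = ptrace (fun t => t ≠ (g s : S)) σ) :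
    ptrace (fun t => t ≠ s) (partialTrace (dropSite ι g) ρ) =
      ptrace (fun t => t ≠ s) (partialTrace (dropSite ι g) σ) := by
  refine ext_entry fun x x' => ?_
  have h1 := hasSum_entry_ptrace_partialTrace g hρ s x x'
  rw [h] at h1
  exact h1.unique (hasSum_entry_ptrace_partialTrace g hσ s x x')

/-- Tracing out the site `s₀` removes its term from a representation of an operator. -/
theorem w1Norm_partialTrace_dropSite_le [Fintype S] [Fintype S'] {c : S → ℝ}
    {ρ σ : S → TensorPow ι S →L[ℂ] TensorPow ι S} (hc : ∀ s, 0 ≤ c s) (hρ : ∀ s, IsDensity (ρ s))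
    (hσ : ∀ s, IsDensity (σ s))
    (h : ∀ s, ptrace (fun t => t ≠ s) (ρ s) = ptrace (fun t => t ≠ s) (σ s)) :
    w1Norm (partialTrace (dropSite ι g) (∑ s, (c s : ℂ) • (ρ s - σ s))) ≤
      ENNReal.ofReal (∑ s, c s - c s₀) := by
  have ht : ∀ s, Traceable (dropSite ι g) (ρ s - σ s) := fun s =>
    (hρ s).traceable.sub (hσ s).traceable
  have hp : ∀ s, partialTrace (dropSite ι g) ((c s : ℂ) • (ρ s - σ s)) =
      (c s : ℂ) • (partialTrace (dropSite ι g) (ρ s) - partialTrace (dropSite ι g) (σ s)) := by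
    intro s
    rw [partialTrace_smul (ht s), partialTrace_sub (hρ s).traceable (hσ s).traceable]
  refine sInf_le ⟨fun s => c (g s), fun s => partialTrace (dropSite ι g) (ρ (g s)),
    fun s => partialTrace (dropSite ι g) (σ (g s)), fun s => hc _, fun s => (hρ _).partialTrace,
    fun s => (hσ _).partialTrace,
    fun s => ptrace_partialTrace_dropSite_congr g (hρ _) (hσ _) s (h _), ?_, ?_⟩
  · rw [partialTrace_sum _ fun s => (ht s).smul _]
    simp only [hp]
    -- The two states of the `s₀` term coincide once `s₀` is traced out.
    rw [Fintype.sum_eq_add_sum_subtype_ne _ s₀,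
      partialTrace_dropSite_congr g (hρ s₀) (hσ s₀) (h s₀), sub_self, smul_zero, zero_add]
    exact (Equiv.sum_comp g fun t => (c t : ℂ) •
      (partialTrace (dropSite ι g) (ρ t) - partialTrace (dropSite ι g) (σ t))).symm
  · rw [Fintype.sum_eq_add_sum_subtype_ne c s₀, add_sub_cancel_left]
    exact congrArg _ (Equiv.sum_comp g fun t => c t).symm

end DropSite

/-! ### Reduced density matrices and monotonicity -/

section ReducedStates

variable {ι : Type*} {n : ℕ}

/-- Exchanging the last of the first `k + 1` sites with `s₀` identifies the first `k` sites with
the first `k + 1` sites other than `s₀`. -/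
def swapLastEquiv {k : ℕ} (hk : k < n) (s₀ : {j : Fin n // (j : ℕ) < k + 1}) :
    {j : Fin n // (j : ℕ) < k} ≃ {t : {j : Fin n // (j : ℕ) < k + 1} // t ≠ s₀} where
  toFun j := ⟨⟨Equiv.swap s₀.1 ⟨k, hk⟩ j, by
      rw [Equiv.swap_apply_def]
      split_ifs
      · simp
      · exact s₀.2
      · exact j.2.trans (Nat.lt_succ_self k)⟩, by
      intro h
      have h1 := congrArg Subtype.val h
      simp only [Equiv.swap_apply_eq_iff, Equiv.swap_apply_left] at h1
      have := congrArg Fin.val h1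
      have h2 := j.2
      simp only at this
      omega⟩
  invFun t := ⟨Equiv.swap s₀.1 ⟨k, hk⟩ t.1, by
      have h1 : t.1.1 ≠ s₀.1 := fun h => t.2 (Subtype.ext h)
      have h2 := t.1.2
      have h3 := s₀.2
      rw [Equiv.swap_apply_def, if_neg h1]
      split_ifs with h
      · have h4 : (t.1.1 : ℕ) = k := congrArg Fin.val h
        have h5 : (t.1.1 : ℕ) ≠ s₀.1 := fun h => h1 (Fin.ext h)
        omega
      · have h4 : (t.1.1 : ℕ) ≠ k := fun h' => h (Fin.ext h')
        omega⟩
  left_inv j := by simp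
  right_inv t := by simp

/-- Splitting of the configurations of the sites from `k` on into the site `k` and the others. -/
def tailEquiv (ι : Type*) {k : ℕ} (hk : k < n) :
    ι × ({j : Fin n // ¬ (j : ℕ) < k + 1} → ι) ≃ ({j : Fin n // ¬ (j : ℕ) < k} → ι) where
  toFun p := fun j => if h : (j.1 : ℕ) < k + 1 then p.1 else p.2 ⟨j, h⟩
  invFun z := (z ⟨⟨k, hk⟩, by simp⟩, fun j => z ⟨j, by have := j.2; omega⟩)
  left_inv p := by
    ext1
    · simp
    · funext j
      simp [j.2]
  right_inv z := by
    funext j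
    by_cases h : (j.1 : ℕ) < k + 1
    · have h1 : (⟨⟨k, hk⟩, by simp⟩ : {j : Fin n // ¬ (j : ℕ) < k}) = j := by
        have := j.2
        exact Subtype.ext (Fin.ext (by simp only; omega))
      simp [h, h1]
    · simp [h]

/-- Tracing out `s₀` instead of the site `k` amounts to transposing these two sites in the full
configuration. -/
theorem siteEquiv_dropSite {k : ℕ} (hk : k < n) (s₀ : {j : Fin n // (j : ℕ) < k + 1})
    (x : {j : Fin n // (j : ℕ) < k} → ι) (i : ι) (w : {j : Fin n // ¬ (j : ℕ) < k + 1} → ι) :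
    siteEquiv ι (fun j : Fin n => (j : ℕ) < k + 1) (dropSite ι (swapLastEquiv hk s₀) (x, i), w) =
      siteEquiv ι (fun j : Fin n => (j : ℕ) < k) (x, tailEquiv ι hk (i, w)) ∘
        Equiv.swap s₀.1 ⟨k, hk⟩ := by
  funext j
  have hs := s₀.2
  simp only [siteEquiv_apply, Function.comp_apply, dropSite_apply, fillSite, tailEquiv,
    swapLastEquiv, Equiv.coe_fn_mk, Equiv.coe_fn_symm_mk]
  by_cases h1 : (j : ℕ) < k + 1
  · by_cases h2 : j = s₀.1
    · subst h2
      simp [h1]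
    · have h3 : (Equiv.swap s₀.1 ⟨k, hk⟩ j : Fin n).1 < k :=
        ((swapLastEquiv hk s₀).symm ⟨⟨j, h1⟩, fun h => h2 (congrArg Subtype.val h)⟩).2
      have h4 : (⟨j, h1⟩ : {j : Fin n // (j : ℕ) < k + 1}) ≠ s₀ :=
        fun h => h2 (congrArg Subtype.val h)
      simp [h1, h3, h4]
  · have h2 : Equiv.swap s₀.1 ⟨k, hk⟩ j = j := by
      refine Equiv.swap_apply_of_ne_of_ne ?_ ?_
      · rintro rfl
        exact h1 hs
      · rintro rfl
        exact h1 (by simp)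
    have h3 : ¬ (j : ℕ) < k := by omega
    simp [h1, h2, h3]

/-- Tracing any one site out of the `(k + 1)`-particle reduced state of an antisymmetric vector
gives the `k`-particle reduced state. -/
theorem partialTrace_dropSite_ptrace {Φ : TensorPow ι (Fin n)} (hΦ : ‖Φ‖ = 1)
    (hanti : ∀ (x : Fin n → ι) (π : Equiv.Perm (Fin n)),
      Φ (x ∘ π) = ((Equiv.Perm.sign π : ℤ) : ℂ) * Φ x)
    {k : ℕ} (hk : k < n) (s₀ : {j : Fin n // (j : ℕ) < k + 1}) :
    partialTrace (dropSite ι (swapLastEquiv hk s₀))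
        (ptrace (fun j : Fin n => (j : ℕ) < k + 1) (pureState Φ)) =
      ptrace (fun j : Fin n => (j : ℕ) < k) (pureState Φ) := by
  have hd := pureState_isDensity hΦ
  refine ext_entry fun x x' => ?_
  have hdk : IsDensity (ptrace (fun j : Fin n => (j : ℕ) < k + 1) (pureState Φ)) :=
    IsDensity.partialTrace (e := siteEquiv ι fun j : Fin n => (j : ℕ) < k + 1) hd
  have h1 := (tailEquiv ι hk).hasSum_iff.2
    (hd.traceable.hasSum_entry (e := siteEquiv ι fun j : Fin n => (j : ℕ) < k) x x')
  refine (hdk.traceable.hasSum_entry x x').unique (h1.prod_fiberwise fun i => ?_)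
  have h2 := hd.traceable.hasSum_entry (e := siteEquiv ι fun j : Fin n => (j : ℕ) < k + 1)
    (dropSite ι (swapLastEquiv hk s₀) (x, i)) (dropSite ι (swapLastEquiv hk s₀) (x', i))
  -- The sign of the transposition enters both factors of an entry of `|Φ⟩⟨Φ|` and cancels.
  have hsign : ∀ π : Equiv.Perm (Fin n), ∀ a c : ℂ,
      ((Equiv.Perm.sign π : ℤ) : ℂ) * a * star (((Equiv.Perm.sign π : ℤ) : ℂ) * c) =
        a * star c := by
    intro π a c
    rcases Int.units_eq_one_or (Equiv.Perm.sign π) with h | h <;> simp [h]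
  simp only [siteEquiv_dropSite, pureState, entry_rankOne, hanti, hsign] at h2
  simp only [pureState, entry_rankOne, Function.comp_apply]
  exact h2

theorem inv_choose_smul_reducedDensity {k : ℕ} (hk : k ≤ n) (Φ : TensorPow ι (Fin n)) :
    (n.choose k : ℂ)⁻¹ • reducedDensity k Φ =
      ptrace (fun j : Fin n => (j : ℕ) < k) (pureState Φ) := by
  have : (n.choose k : ℂ) ≠ 0 := Nat.cast_ne_zero.2 (Nat.choose_pos hk).ne'
  rw [reducedDensity, smul_smul, inv_mul_cancel₀ this, one_smul]

theorem inv_mul_w1Norm_ptrace_le {Φ Ψ : TensorPow ι (Fin n)} (hΦ : ‖Φ‖ = 1) (hΨ : ‖Ψ‖ = 1)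
    (hantiΦ : ∀ (x : Fin n → ι) (π : Equiv.Perm (Fin n)),
      Φ (x ∘ π) = ((Equiv.Perm.sign π : ℤ) : ℂ) * Φ x)
    (hantiΨ : ∀ (x : Fin n → ι) (π : Equiv.Perm (Fin n)),
      Ψ (x ∘ π) = ((Equiv.Perm.sign π : ℤ) : ℂ) * Ψ x)
    {k : ℕ} (hk0 : 0 < k) (hk : k < n) :
    (k : ℝ≥0∞)⁻¹ * w1Norm (ptrace (fun j : Fin n => (j : ℕ) < k) (pureState Φ) -
        ptrace (fun j : Fin n => (j : ℕ) < k) (pureState Ψ)) ≤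
      ((k + 1 : ℕ) : ℝ≥0∞)⁻¹ *
        w1Norm (ptrace (fun j : Fin n => (j : ℕ) < k + 1) (pureState Φ) -
          ptrace (fun j : Fin n => (j : ℕ) < k + 1) (pureState Ψ)) := by
  -- With `k + 1` moved to the left, the infimum stands alone on the right, and it suffices to treat
  -- each representation.
  rw [← ENNReal.mul_le_iff_le_inv (by simp) (ENNReal.natCast_ne_top _)]
  refine le_sInf ?_
  rintro _ ⟨c, ρ, σ, hc, hρ, hσ, hp, heq, rfl⟩
  have hne : (Finset.univ : Finset {j : Fin n // (j : ℕ) < k + 1}).Nonempty :=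
    ⟨⟨⟨k, hk⟩, by simp⟩, Finset.mem_univ _⟩
  obtain ⟨s₀, -, hs₀⟩ := Finset.exists_max_image Finset.univ c hne
  have hdΦ : IsDensity (ptrace (fun j : Fin n => (j : ℕ) < k + 1) (pureState Φ)) :=
    IsDensity.partialTrace (e := siteEquiv ι fun j : Fin n => (j : ℕ) < k + 1)
      (pureState_isDensity hΦ)
  have hdΨ : IsDensity (ptrace (fun j : Fin n => (j : ℕ) < k + 1) (pureState Ψ)) :=
    IsDensity.partialTrace (e := siteEquiv ι fun j : Fin n => (j : ℕ) < k + 1)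
      (pureState_isDensity hΨ)
  have hle := w1Norm_partialTrace_dropSite_le (swapLastEquiv hk s₀) hc hρ hσ hp
  rw [← heq, partialTrace_sub hdΦ.traceable hdΨ.traceable,
    partialTrace_dropSite_ptrace hΦ hantiΦ, partialTrace_dropSite_ptrace hΨ hantiΨ] at hle
  -- The largest cost is at least the mean over the `k + 1` sites, so removing it leaves at most
  -- `k/(k+1)` of the total.
  have hsum : ∑ s, c s ≤ (k + 1) * c s₀ := by
    have h1 := Finset.sum_le_card_nsmul Finset.univ c (c s₀) hs₀
    rw [Finset.card_univ, Fintype.card_fin_lt_of_le (by omega), nsmul_eq_mul] at h1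
    exact_mod_cast h1
  have hk0' : (0 : ℝ) < k := Nat.cast_pos.2 hk0
  calc ((k + 1 : ℕ) : ℝ≥0∞) * ((k : ℝ≥0∞)⁻¹ * _)
      ≤ ((k + 1 : ℕ) : ℝ≥0∞) * ((k : ℝ≥0∞)⁻¹ * ENNReal.ofReal (∑ s, c s - c s₀)) := by
        gcongr
    _ = ENNReal.ofReal ((k + 1 : ℕ) * ((k : ℝ)⁻¹ * (∑ s, c s - c s₀))) := by
        rw [ENNReal.ofReal_mul (by positivity), ENNReal.ofReal_mul (by positivity),
          ENNReal.ofReal_inv_of_pos hk0', ENNReal.ofReal_natCast, ENNReal.ofReal_natCast]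
    _ ≤ ENNReal.ofReal (∑ s, c s) := by
        refine ENNReal.ofReal_le_ofReal ?_
        rw [mul_left_comm, inv_mul_le_iff₀ hk0']
        push_cast
        linarith

end ReducedStates

end

end QSlater

/-! ### The theorem -/

theorem theorem3p1 {H ι : Type*} [NormedAddCommGroup H] [InnerProductSpace ℂ H] [CompleteSpace H]
    (b : HilbertBasis ι ℂ H) (n : ℕ) (ψ φ : Fin n → H)
    (hψ : Orthonormal ℂ ψ) (hφ : Orthonormal ℂ φ) :
    (∃ m : ℝ, IsGreatest (QSlater.overlaps ψ φ) m ∧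
      QSlater.w1Norm (QSlater.pureState (QSlater.slater b ψ) -
          QSlater.pureState (QSlater.slater b φ)) ≤
        ENNReal.ofReal (n * Real.sqrt (1 - m))) ∧
    MonotoneOn
      (fun k : ℕ => (k : ENNReal)⁻¹ *
        QSlater.w1Norm
          ((n.choose k : ℂ)⁻¹ • QSlater.reducedDensity k (QSlater.slater b φ) -
            (n.choose k : ℂ)⁻¹ • QSlater.reducedDensity k (QSlater.slater b ψ)))
      (Set.Icc 1 n) := by
  constructor
  · obtain ⟨m, hm⟩ := QSlater.exists_isGreatest_overlaps hψ hφ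
    exact ⟨m, hm, QSlater.w1Norm_slater_le_of_mem_overlaps b hψ hφ hm.1⟩
  · refine monotoneOn_of_le_add_one Set.ordConnected_Icc fun k _ hk hk1 => ?_
    have h0 : 0 < k := hk.1
    have hn : k < n := hk1.2
    simp only [QSlater.inv_choose_smul_reducedDensity hk.2,
      QSlater.inv_choose_smul_reducedDensity hk1.2]
    exact QSlater.inv_mul_w1Norm_ptrace_le (QSlater.norm_slater b hφ (h0.trans hn))
      (QSlater.norm_slater b hψ (h0.trans hn)) (QSlater.slater_comp_perm b φ)
      (QSlater.slater_comp_perm b ψ) h0 hn
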